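/- Consider the $K$-armed stochastic bandit problem with arm distributions $\nu=(\nu_1,\dots,\nu_K)$ on $[0,1]$ with means $\mu_a=\mathbb{E}[\nu_a]$; put $\mu^*=\max_a\mu_a$ and $\Delta_a=\mu^*-\mu_a$. A (possibly randomized) strategy selects in each round $t$ an arm $a_t$ on the basis of the past arms and rewards $a_1,X_1,\dots,a_{t-1},X_{t-1}$; given $a_t$ and the past, the reward $X_t$ has law $\nu_{a_t}$. Let $N_k(T+1)=\sum_{t=1}^T\mathbf 1\{a_t=k\}$. For $\epsilon\in[0,1]$, an $\epsilon$-gap function is a function $f:[0,1]\to[0,\infty)$ with $f(x)=0$ for $x\in[0,\epsilon]$ and $f(x)>0$ for $x\in(\epsilon,1]$, and the lenient regret is $R_f(T)=\mathbb{E}\bigl[\sum_{t=1}^T f(\Delta_{a_t})\bigr]$. Let $\mathcal{D}$ be a set of probability distributions on $[0,1]$. A strategy is consistent over $\mathcal{D}$ w.r.t. $f$ if $R_f(T)=o(T^\alpha)$ as $T\to\infty$ for every $0<\alpha\le 1$ and every $K$-armed bandit problem whose arm distributions all lie in $\mathcal{D}$. Let $\mathcal{K}_{\inf}(\nu,x,\mathcal{D})=\inf\{\mathrm{KL}(\nu,\nu'):\nu'\in\mathcal{D},\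 \mathbb{E}[\nu']>x\}\in[0,\infty]$, where $\inf\emptyset=\infty$, and use the convention $c/\infty=0$. Theorem. Let $\epsilon\in[0,1]$, let $f$ be an $\epsilon$-gap function, and consider any strategy that is consistent over $\mathcal{D}$ w.r.t. $f$. Then for every bandit problem $\nu$ with $\nu_a\in\mathcal{D}$ for all $a$: 1. for every arm $k$ with $\Delta_k>\epsilon$, $$\liminf_{T\to\infty}\frac{\mathbb{E}[N_k(T+1)]}{\ln T}\ \ge\ \frac{1}{\mathcal{K}_{\inf}(\nu_k,\mu^*+\epsilon,\mathcal{D})};$$ 2. $$\liminf_{T\to\infty}\frac{R_f(T)}{\ln T}\ \ge\ \sum_{a:\Delta_a>\epsilon}\frac{f(\Delta_a)}{\mathcal{K}_{\inf}(\nu_a,\mu^*+\epsilon,\mathcal{D})};$$ 3. if $\mu^*>1-\epsilon$, then $\mathcal{K}_{\inf}(\nu_a,\mu^*+\epsilon,\mathcal{D})=\infty$ for every arm $a$, so the lower bound in (2) equals $0$ (that is, the lower bound is sub-logarithmic). -/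

import Mathlib

open MeasureTheory ProbabilityTheory

namespace LenientBandit

/-- Histories `(a_1, X_1, …, a_t, X_t)` of length `t` for `K` arms and rewards in `[0,1]`. -/
abbrev History (K t : ℕ) : Type := Fin t → Fin K × unitInterval

/-- A (randomized) bandit strategy with `K` arms: given the history of the first `t` rounds,
`policy t` is the distribution of the arm selected in round `t + 1`. -/
structure Strategy (K : ℕ) where
  policy : (t : ℕ) → Kernel (History K t) (Fin K)
  markov : ∀ t, IsMarkovKernel (policy t)

attribute [instance] Strategy.markov

/-- A bandit problem with `K` arms: one distribution on `[0,1]` for each arm. -/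
abbrev Problem (K : ℕ) : Type := Fin K → ProbabilityMeasure unitInterval

/-- The reward distribution as a kernel of the selected arm. -/
noncomputable def rewardKernel {K : ℕ} (ν : Problem K) : Kernel (Fin K) unitInterval where
  toFun a := (ν a : Measure unitInterval)
  measurable' := measurable_of_countable _

instance {K : ℕ} (ν : Problem K) : IsMarkovKernel (rewardKernel ν) :=
  ⟨fun a => inferInstanceAs (IsProbabilityMeasure (ν a : Measure unitInterval))⟩

/-- One round: an arm `a` is drawn from the policy given the past, then a reward is drawn
from `ν a`, conditionally independently of the past given `a`. -/
noncomputable def roundKernel {K : ℕ} (π : Strategy K) (ν : Problem K) (t : ℕ) :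
    Kernel (History K t) (Fin K × unitInterval) :=
  π.policy t ⊗ₖ Kernel.prodMkLeft (History K t) (rewardKernel ν)

instance {K : ℕ} (π : Strategy K) (ν : Problem K) (t : ℕ) :
    IsMarkovKernel (roundKernel π ν t) := by
  unfold roundKernel; infer_instance

/-- The law of `(a_1, X_1, …, a_T, X_T)` when the strategy `π` interacts with the problem `ν`. -/
noncomputable def historyLaw {K : ℕ} (π : Strategy K) (ν : Problem K) :
    (T : ℕ) → Measure (History K T)
  | 0 => Measure.dirac Fin.elim0
  | T + 1 => (historyLaw π ν T ⊗ₘ roundKernel π ν T).map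
      (fun p => (Fin.snoc p.1 p.2 : History K (T + 1)))

theorem measurable_snoc (K T : ℕ) :
    Measurable (fun p : History K T × (Fin K × unitInterval) =>
      (Fin.snoc p.1 p.2 : History K (T + 1))) := by
  refine measurable_pi_lambda _ fun i => ?_
  refine Fin.lastCases ?_ (fun j => ?_) i
  · simpa using measurable_snd
  · simp only [Fin.snoc_castSucc]
    exact (measurable_pi_apply j).comp measurable_fst

instance {K : ℕ} (π : Strategy K) (ν : Problem K) (T : ℕ) :
    IsProbabilityMeasure (historyLaw π ν T) := by
  induction T with
  | zero => unfold historyLaw; infer_instance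
  | succ T ih =>
    unfold historyLaw
    exact Measure.isProbabilityMeasure_map (measurable_snoc K T).aemeasurable

/-- The mean of a distribution on `[0,1]`. -/
noncomputable def mean (ν : ProbabilityMeasure unitInterval) : ℝ :=
  ∫ x, (x : ℝ) ∂(ν : Measure unitInterval)

/-- The mean `μ*` of an optimal arm. -/
noncomputable def bestMean {K : ℕ} (ν : Problem K) : ℝ := ⨆ a, mean (ν a)

/-- The suboptimality gap `Δ_a = μ* - μ_a`. -/
noncomputable def gap {K : ℕ} (ν : Problem K) (a : Fin K) : ℝ := bestMean ν - mean (ν a)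

/-- `f` is an `ε`-gap function; gaps lie in `[0,1]`, so only the values of `f` there matter. -/
def IsGapFunction (ε : ℝ) (f : ℝ → ℝ) : Prop :=
  (∀ x ∈ Set.Icc 0 ε, f x = 0) ∧ ∀ x ∈ Set.Ioc ε 1, 0 < f x

/-- The number of pulls of arm `k` along a history of `T` rounds, i.e. `N_k(T + 1)`. -/
def numPulls {K T : ℕ} (h : History K T) (k : Fin K) : ℕ :=
  (Finset.univ.filter fun t : Fin T => (h t).1 = k).card

/-- `E[N_k(T + 1)]`: the expected number of pulls of arm `k` in the first `T` rounds. -/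
noncomputable def expectedPulls {K : ℕ} (π : Strategy K) (ν : Problem K) (k : Fin K) (T : ℕ) : ℝ :=
  ∫ h, (numPulls h k : ℝ) ∂(historyLaw π ν T)

/-- The lenient regret `R_f(T) = E[∑_{t=1}^T f(Δ_{a_t})]`. -/
noncomputable def lenientRegret {K : ℕ} (f : ℝ → ℝ) (π : Strategy K) (ν : Problem K) (T : ℕ) : ℝ :=
  ∫ h, (∑ t : Fin T, f (gap ν (h t).1)) ∂(historyLaw π ν T)

/-- Consistency over `D` w.r.t. `f`: `R_f(T) = o(T^α)` for every `0 < α ≤ 1` and every bandit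
problem with arm distributions in `D`. -/
def IsConsistent {K : ℕ} (D : Set (ProbabilityMeasure unitInterval)) (f : ℝ → ℝ)
    (π : Strategy K) : Prop :=
  ∀ ν : Problem K, (∀ a, ν a ∈ D) → ∀ α : ℝ, 0 < α → α ≤ 1 →
    Asymptotics.IsLittleO Filter.atTop (fun T : ℕ => lenientRegret f π ν T)
      (fun T : ℕ => (T : ℝ) ^ α)

/-- `K_inf(ν, x, D) = inf {KL(ν, ν') : ν' ∈ D, E[ν'] > x}`, with `inf ∅ = ∞`. -/
noncomputable def Kinf (ν : ProbabilityMeasure unitInterval) (x : ℝ)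
    (D : Set (ProbabilityMeasure unitInterval)) : ENNReal :=
  ⨅ ν' ∈ {ν' ∈ D | x < mean ν'},
    InformationTheory.klDiv (ν : Measure unitInterval) (ν' : Measure unitInterval)

end LenientBandit

/-! Fix a law `q` in `D` with mean above `μ* + ε` and give it to arm `k`. In the new problem every
other arm has gap above `ε`, so consistency forces almost all pulls onto `k`; in the original
problem `k` itself is rarely pulled. The history must tell the two problems apart, yet only pulls of
`k` carry information, each worth `KL(ν_k, q)` (`klDiv_historyLaw_le`). Donsker-Varadhan, applied to
`l` times the fraction of rounds not spent on `k`, makes this quantitative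
(`mul_one_sub_expectedPulls_le`). With `l = (1 - α) log T` the log-moment term is at most `log 2`,
leaving `(1 - α) log T ≲ KL(ν_k, q) E[N_k]`; then `α → 0`, and `q` is optimized. The regret bound
follows by linearity in the pull counts and superadditivity of `liminf`. -/

open MeasureTheory ProbabilityTheory

namespace LenientBandit

open InformationTheory

open scoped ENNReal

/-! ### Divergence: conditional form and variational bound -/

/-- Conditional Kullback-Leibler divergence in integral form, for dominated kernels. -/
theorem klDiv_compProd_right_eq_lintegral {α β : Type*} {mα : MeasurableSpace α}
    {mβ : MeasurableSpace β} [MeasurableSpace.CountableOrCountablyGenerated α β]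
    (ρ : Measure α) [IsFiniteMeasure ρ] (κ η : Kernel α β) [IsMarkovKernel κ] [IsMarkovKernel η]
    (hac : ∀ a, κ a ≪ η a) :
    klDiv (ρ ⊗ₘ κ) (ρ ⊗ₘ η) = ∫⁻ a, klDiv (κ a) (η a) ∂ρ := by
  -- By domination `κ` has a jointly measurable density over `η`, which then also serves as the
  -- density between the two composed measures.
  have hκ : η.withDensity (κ.rnDeriv η) = κ := by
    ext1 a
    exact Kernel.withDensity_rnDeriv_eq (hac a)
  have : IsSFiniteKernel (η.withDensity (κ.rnDeriv η)) := by rw [hκ]; infer_instance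
  have hd : Measurable (fun p : α × β => κ.rnDeriv η p.1 p.2) := Kernel.measurable_rnDeriv κ η
  have hρ : ρ ⊗ₘ κ = (ρ ⊗ₘ η).withDensity (fun p => κ.rnDeriv η p.1 p.2) := by
    conv_lhs => rw [← hκ]
    exact Measure.compProd_withDensity hd
  have hac' : ρ ⊗ₘ κ ≪ ρ ⊗ₘ η := by
    rw [hρ]; exact withDensity_absolutelyContinuous _ _
  have hrn : (ρ ⊗ₘ κ).rnDeriv (ρ ⊗ₘ η) =ᵐ[ρ ⊗ₘ η] fun p => κ.rnDeriv η p.1 p.2 := by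
    rw [hρ]; exact Measure.rnDeriv_withDensity _ hd
  rw [klDiv_eq_lintegral_klFun_of_ac hac']
  calc _ = ∫⁻ p, ENNReal.ofReal (klFun (κ.rnDeriv η p.1 p.2).toReal) ∂(ρ ⊗ₘ η) := by
        refine lintegral_congr_ae ?_
        filter_upwards [hrn] with p hp
        rw [hp]
    _ = ∫⁻ a, ∫⁻ b, ENNReal.ofReal (klFun (κ.rnDeriv η a b).toReal) ∂(η a) ∂ρ :=
        Measure.lintegral_compProd
          (measurable_klFun.comp hd.ennreal_toReal).ennreal_ofReal
    _ = _ := by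
        refine lintegral_congr fun a => ?_
        rw [klDiv_eq_lintegral_klFun_of_ac (hac a)]
        refine lintegral_congr_ae ?_
        filter_upwards [Kernel.rnDeriv_eq_rnDeriv_measure (κ := κ) (η := η) (a := a)] with b hb
        rw [hb]

/-- The Donsker-Varadhan inequality for a bounded test function. -/
theorem integral_le_toReal_klDiv_add_log {α : Type*} {mα : MeasurableSpace α}
    {P Q : Measure α} [IsProbabilityMeasure P] [IsProbabilityMeasure Q] (hPQ : klDiv P Q ≠ ⊤)
    {g : α → ℝ} (hg : Measurable g) {C : ℝ} (hC : ∀ x, |g x| ≤ C) :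
    ∫ x, g x ∂P ≤ (klDiv P Q).toReal + Real.log (∫ x, Real.exp (g x) ∂Q) := by
  obtain ⟨hac, hint⟩ := klDiv_ne_top_iff.1 hPQ
  have hgP : Integrable g P :=
    .of_bound hg.aestronglyMeasurable C (.of_forall fun x => by simpa using hC x)
  have hgQ : Integrable (fun x => Real.exp (g x)) Q :=
    .of_bound hg.exp.aestronglyMeasurable (Real.exp C) (.of_forall fun x => by
      simpa [abs_of_pos (Real.exp_pos _)] using (le_abs_self _).trans (hC x))
  -- The inequality is the nonnegativity of the divergence of `P` from `Q` tilted by `g`, expanded.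
  have := isProbabilityMeasure_tilted hgQ
  have h0 := integral_llr_add_sub_measure_univ_nonneg
    (hac.trans (absolutelyContinuous_tilted hgQ)) (integrable_llr_tilted_right hac hgP hint hgQ)
  rw [integral_llr_tilted_right hac hgP hgQ hint] at h0
  simp only [probReal_univ] at h0
  rw [toReal_klDiv_of_measure_eq hac (by simp)]
  linarith

/-! ### Divergence between history laws -/

variable {K : ℕ}

theorem roundKernel_apply (π : Strategy K) (ν : Problem K) (T : ℕ) (h : History K T) :
    roundKernel π ν T h = π.policy T h ⊗ₘ rewardKernel ν := by
  rw [roundKernel, Kernel.compProd_apply_eq_compProd_sectR]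
  rfl

/-- Both rounds share the policy, so only the reward laws contribute, weighted by the probability of
selecting each arm. -/
theorem klDiv_roundKernel (π : Strategy K) (ν ν' : Problem K) (T : ℕ) (h : History K T)
    (hac : ∀ a, (ν a : Measure unitInterval) ≪ (ν' a : Measure unitInterval)) :
    klDiv (roundKernel π ν T h) (roundKernel π ν' T h) =
      ∑ a, klDiv (ν a : Measure unitInterval) (ν' a) * π.policy T h {a} := by
  rw [roundKernel_apply, roundKernel_apply, klDiv_compProd_right_eq_lintegral _ _ _ hac, lintegral_fintype]
  rfl

theorem roundKernel_absolutelyContinuous (π : Strategy K) (ν ν' : Problem K) (T : ℕ)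
    (h : History K T)
    (hac : ∀ a, (ν a : Measure unitInterval) ≪ (ν' a : Measure unitInterval)) :
    roundKernel π ν T h ≪ roundKernel π ν' T h := by
  rw [roundKernel_apply, roundKernel_apply]
  exact Measure.AbsolutelyContinuous.compProd_right (.of_forall hac)

theorem measurable_numPulls (T : ℕ) (k : Fin K) :
    Measurable (fun h : History K T => numPulls h k) := by
  simp only [numPulls, Finset.card_filter]
  refine Finset.measurable_sum _ fun t _ => ?_
  have : Measurable fun a : Fin K => if a = k then 1 else 0 := measurable_of_countable _
  exact this.comp (measurable_fst.comp (measurable_pi_apply t))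

theorem numPulls_le {T : ℕ} (h : History K T) (k : Fin K) : numPulls h k ≤ T :=
  (Finset.card_filter_le _ _).trans_eq (by simp)

theorem numPulls_snoc {T : ℕ} (h : History K T) (p : Fin K × unitInterval) (k : Fin K) :
    numPulls (Fin.snoc h p : History K (T + 1)) k = numPulls h k + if p.1 = k then 1 else 0 := by
  simp only [numPulls, Finset.card_filter, Fin.sum_univ_castSucc, Fin.snoc_castSucc, Fin.snoc_last]

theorem integrable_numPulls (π : Strategy K) (ν : Problem K) (T : ℕ) (k : Fin K) :
    Integrable (fun h => (numPulls h k : ℝ)) (historyLaw π ν T) :=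
  .of_bound (measurable_from_top.comp (measurable_numPulls T k)).aestronglyMeasurable T
    (.of_forall fun h => by simpa using numPulls_le h k)

theorem ofReal_expectedPulls (π : Strategy K) (ν : Problem K) (T : ℕ) (k : Fin K) :
    ENNReal.ofReal (expectedPulls π ν k T) = ∫⁻ h, (numPulls h k : ℝ≥0∞) ∂historyLaw π ν T := by
  rw [expectedPulls, ofReal_integral_eq_lintegral_ofReal (integrable_numPulls π ν T k)
    (.of_forall fun h => by positivity)]
  simp

theorem lintegral_roundKernel_fst_eq (π : Strategy K) (ν : Problem K) (T : ℕ) (h : History K T)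
    (k : Fin K) :
    ∫⁻ p, (if p.1 = k then 1 else 0 : ℝ≥0∞) ∂roundKernel π ν T h = π.policy T h {k} := by
  have hm : Measurable fun a : Fin K => (if a = k then 1 else 0 : ℝ≥0∞) := measurable_of_countable _
  rw [roundKernel, Kernel.lintegral_compProd (f := fun p => if p.1 = k then 1 else 0) _ _ _
    (hm.comp measurable_fst)]
  rw [lintegral_fintype, Finset.sum_eq_single k]
  · simp
  · intro a _ ha
    simp [ha]
  · simp

theorem lintegral_numPulls_succ (π : Strategy K) (ν : Problem K) (T : ℕ) (k : Fin K) :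
    ∫⁻ h, (numPulls h k : ℝ≥0∞) ∂historyLaw π ν (T + 1) =
      ∫⁻ h, (numPulls h k : ℝ≥0∞) ∂historyLaw π ν T +
        ∫⁻ h, π.policy T h {k} ∂historyLaw π ν T := by
  have hN (T : ℕ) : Measurable fun h : History K T => (numPulls h k : ℝ≥0∞) :=
    measurable_from_top.comp (measurable_numPulls T k)
  have hm : Measurable fun a : Fin K => (if a = k then 1 else 0 : ℝ≥0∞) := measurable_of_countable _
  rw [historyLaw, lintegral_map (hN _) (measurable_snoc K T)]
  simp only [numPulls_snoc, Nat.cast_add, Nat.cast_ite, Nat.cast_one, Nat.cast_zero]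
  rw [lintegral_add_left
      (f := fun p : History K T × (Fin K × unitInterval) => (numPulls p.1 k : ℝ≥0∞))
      ((hN T).comp measurable_fst),
    Measure.lintegral_compProd
      (f := fun p : History K T × (Fin K × unitInterval) => (numPulls p.1 k : ℝ≥0∞))
      ((hN T).comp measurable_fst),
    Measure.lintegral_compProd
      (f := fun p : History K T × (Fin K × unitInterval) => if p.2.1 = k then 1 else 0)
      (hm.comp (measurable_fst.comp measurable_snd))]
  simp [lintegral_roundKernel_fst_eq]

/-- The divergence between the laws of the histories under two problems that differ only in arm
`k` is at most the expected number of pulls of `k` times the divergence between the two laws. -/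
theorem klDiv_historyLaw_le (π : Strategy K) (ν : Problem K) (k : Fin K)
    (q : ProbabilityMeasure unitInterval)
    (hac : (ν k : Measure unitInterval) ≪ (q : Measure unitInterval)) (T : ℕ) :
    klDiv (historyLaw π ν T) (historyLaw π (Function.update ν k q) T) ≤
      klDiv (ν k : Measure unitInterval) q * ENNReal.ofReal (expectedPulls π ν k T) := by
  rw [ofReal_expectedPulls]
  set ν' := Function.update ν k q with hν'
  have hac' : ∀ a, (ν a : Measure unitInterval) ≪ (ν' a : Measure unitInterval) := by
    intro a
    obtain rfl | ha := eq_or_ne a k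
    · simpa [hν'] using hac
    · simp [hν', ha, Measure.AbsolutelyContinuous.rfl]
  induction T with
  | zero => simp [historyLaw]
  | succ T ih =>
    rw [lintegral_numPulls_succ, mul_add]
    calc klDiv (historyLaw π ν (T + 1)) (historyLaw π ν' (T + 1))
        ≤ klDiv (historyLaw π ν T ⊗ₘ roundKernel π ν T)
            (historyLaw π ν' T ⊗ₘ roundKernel π ν' T) :=
          klDiv_map_le _ _ (measurable_snoc K T)
      _ = klDiv (historyLaw π ν T) (historyLaw π ν' T) +
            ∫⁻ h, klDiv (roundKernel π ν T h) (roundKernel π ν' T h) ∂historyLaw π ν T := by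
          -- Chain rule: the new round contributes its conditional divergence, averaged under the
          -- original problem `ν`.
          rw [klDiv_compProd_eq_add, klDiv_compProd_right_eq_lintegral _ _ _
            fun h => roundKernel_absolutelyContinuous π ν ν' T h hac']
      _ ≤ _ := by
          refine add_le_add ih ?_
          rw [← lintegral_const_mul _ ((π.policy T).measurable_coe (measurableSet_singleton k))]
          refine lintegral_mono fun h => ?_
          rw [klDiv_roundKernel π ν ν' T h hac', Finset.sum_eq_single k]
          · simp [hν']
          · intro a _ ha
            simp [hν', ha]
          · simp


/-! ### Expected pulls, regret and gaps -/

theorem expectedPulls_nonneg (π : Strategy K) (ν : Problem K) (k : Fin K) (T : ℕ) :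
    0 ≤ expectedPulls π ν k T :=
  integral_nonneg fun _ => by positivity

theorem sum_expectedPulls (π : Strategy K) (ν : Problem K) (T : ℕ) :
    ∑ a, expectedPulls π ν a T = T := by
  have hsum (h : History K T) : ∑ a, (numPulls h a : ℝ) = T := by
    have := Finset.card_eq_sum_card_fiberwise (s := Finset.univ) (t := Finset.univ)
      (f := fun t : Fin T => (h t).1) (by simp)
    simp only [Finset.card_univ, Fintype.card_fin] at this
    rw [← Nat.cast_sum]
    exact congrArg _ this.symm
  simp only [expectedPulls]
  rw [← integral_finsetSum _ fun a _ => integrable_numPulls π ν T a]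
  simp [hsum]

theorem lenientRegret_eq_sum (f : ℝ → ℝ) (π : Strategy K) (ν : Problem K) (T : ℕ) :
    lenientRegret f π ν T = ∑ a, f (gap ν a) * expectedPulls π ν a T := by
  have hsum (h : History K T) :
      ∑ t, f (gap ν (h t).1) = ∑ a, f (gap ν a) * (numPulls h a : ℝ) := by
    rw [← Finset.sum_fiberwise_of_maps_to (g := fun t => (h t).1) (t := Finset.univ) (by simp)]
    refine Finset.sum_congr rfl fun a _ => ?_
    rw [Finset.sum_congr rfl fun t ht => by rw [(Finset.mem_filter.1 ht).2], Finset.sum_const,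
      nsmul_eq_mul, mul_comm]
    rfl
  simp only [lenientRegret, expectedPulls, hsum]
  rw [integral_finsetSum _ fun a _ => (integrable_numPulls π ν T a).const_mul _]
  simp only [integral_const_mul]

theorem mean_nonneg (p : ProbabilityMeasure unitInterval) : 0 ≤ mean p :=
  integral_nonneg fun x => x.2.1

theorem mean_le_one (p : ProbabilityMeasure unitInterval) : mean p ≤ 1 := by
  have hi : Integrable (fun x : unitInterval => (x : ℝ)) (p : Measure unitInterval) :=
    .of_bound measurable_subtype_coe.aestronglyMeasurable 1 (.of_forall fun x => by
      simpa [abs_of_nonneg x.2.1] using x.2.2)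
  calc mean p ≤ ∫ _, (1 : ℝ) ∂(p : Measure unitInterval) :=
        integral_mono hi (integrable_const _) fun x => x.2.2
    _ = 1 := by simp

theorem mean_le_bestMean (ν : Problem K) (a : Fin K) : mean (ν a) ≤ bestMean ν :=
  le_ciSup (f := fun a => mean (ν a)) (Set.finite_range _).bddAbove a

theorem gap_nonneg (ν : Problem K) (a : Fin K) : 0 ≤ gap ν a :=
  sub_nonneg.2 (mean_le_bestMean ν a)

theorem gap_le_one (ν : Problem K) (a : Fin K) : gap ν a ≤ 1 := by
  have h1 : bestMean ν ≤ 1 := Real.iSup_le (fun a => mean_le_one (ν a)) zero_le_one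
  have := mean_nonneg (ν a)
  unfold gap
  linarith

theorem IsGapFunction.nonneg_gap {ε : ℝ} {f : ℝ → ℝ} (hf : IsGapFunction ε f) (ν : Problem K)
    (a : Fin K) : 0 ≤ f (gap ν a) := by
  rcases le_or_gt (gap ν a) ε with h | h
  · exact (hf.1 _ ⟨gap_nonneg ν a, h⟩).ge
  · exact (hf.2 _ ⟨h, gap_le_one ν a⟩).le

/-! ### Consistency and change of measure -/

/-- A consistent strategy rarely pulls arms whose gap exceeds `ε`. -/
theorem IsConsistent.isLittleO_expectedPulls {ε : ℝ} {f : ℝ → ℝ} (hf : IsGapFunction ε f)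
    {D : Set (ProbabilityMeasure unitInterval)} {π : Strategy K} (hπ : IsConsistent D f π)
    {ν : Problem K} (hν : ∀ a, ν a ∈ D) {k : Fin K} (hk : ε < gap ν k) {α : ℝ} (hα : 0 < α)
    (hα1 : α ≤ 1) :
    (fun T : ℕ => expectedPulls π ν k T) =o[Filter.atTop] fun T : ℕ => (T : ℝ) ^ α := by
  have hc : 0 < f (gap ν k) := hf.2 _ ⟨hk, gap_le_one ν k⟩
  refine Asymptotics.IsBigO.trans_isLittleO (.of_bound (f (gap ν k))⁻¹ (.of_forall fun T => ?_))
    (hπ ν hν α hα hα1)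
  have hle : f (gap ν k) * expectedPulls π ν k T ≤ lenientRegret f π ν T := by
    rw [lenientRegret_eq_sum]
    exact Finset.single_le_sum (f := fun a => f (gap ν a) * expectedPulls π ν a T)
      (fun a _ => mul_nonneg (hf.nonneg_gap ν a) (expectedPulls_nonneg π ν a T))
      (Finset.mem_univ k)
  rw [Real.norm_of_nonneg (expectedPulls_nonneg π ν k T), inv_mul_eq_div, le_div_iff₀ hc,
    mul_comm]
  exact hle.trans (le_abs_self _)

/-- When arm `k` is replaced by one whose mean exceeds the best mean by more than `ε`, every other
arm has a gap above `ε`. -/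
theorem lt_gap_update {ε : ℝ} (ν : Problem K) (k : Fin K) (q : ProbabilityMeasure unitInterval)
    (hq : bestMean ν + ε < mean q) {a : Fin K} (ha : a ≠ k) :
    ε < gap (Function.update ν k q) a := by
  have h1 := mean_le_bestMean (Function.update ν k q) k
  have h2 := mean_le_bestMean ν a
  rw [Function.update_self] at h1
  rw [gap, Function.update_of_ne ha]
  linarith

/-- A convex function lies below its chord on `[0,1]`. This makes the exponential moment of a
`[0,1]`-valued variable linear in its mean. -/
theorem exp_mul_le_one_add {l z : ℝ} (h0 : 0 ≤ z) (h1 : z ≤ 1) :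
    Real.exp (l * z) ≤ 1 + (Real.exp l - 1) * z := by
  have := convexOn_exp.2 (Set.mem_univ 0) (Set.mem_univ l) (sub_nonneg.2 h1) h0 (by ring)
  simp only [smul_eq_mul, mul_zero, zero_add, Real.exp_zero, mul_one] at this
  rw [mul_comm l z]
  linarith

/-- Change of measure applied to the fraction of rounds in which arm `k` is not pulled. -/
theorem mul_one_sub_expectedPulls_le (π : Strategy K) (ν : Problem K) (k : Fin K)
    (q : ProbabilityMeasure unitInterval)
    (hq : klDiv (ν k : Measure unitInterval) (q : Measure unitInterval) ≠ ⊤) {l : ℝ} (hl : 0 ≤ l)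
    (T : ℕ) :
    l * (1 - expectedPulls π ν k T / T) ≤
      (klDiv (ν k : Measure unitInterval) (q : Measure unitInterval)).toReal *
          expectedPulls π ν k T +
        Real.log (1 + (Real.exp l - 1) *
          (1 - expectedPulls π (Function.update ν k q) k T / T)) := by
  set ν' := Function.update ν k q
  have hle := klDiv_historyLaw_le π ν k q (klDiv_ne_top_iff.1 hq).1 T
  have htop : klDiv (ν k : Measure unitInterval) (q : Measure unitInterval) *
      ENNReal.ofReal (expectedPulls π ν k T) ≠ ⊤ := ENNReal.mul_ne_top hq ENNReal.ofReal_ne_top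
  have hle' := ENNReal.toReal_mono htop hle
  rw [ENNReal.toReal_mul, ENNReal.toReal_ofReal (expectedPulls_nonneg π ν k T)] at hle'
  -- The fraction of rounds not spent on `k`. For `T = 0` the quotient is `0`, so `z` stays in
  -- `[0,1]`.
  let z : History K T → ℝ := fun h => 1 - (numPulls h k : ℝ) / T
  have hN : Measurable fun h : History K T => (numPulls h k : ℝ) :=
    measurable_from_top.comp (measurable_numPulls T k)
  have hz : Measurable z := measurable_const.sub (hN.div_const _)
  have hz0 h : 0 ≤ z h :=
    sub_nonneg.2 (div_le_one_of_le₀ (by exact_mod_cast numPulls_le h k) (by positivity))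
  have hz1 h : z h ≤ 1 := sub_le_self _ (by positivity)
  have hzint (ν : Problem K) : Integrable z (historyLaw π ν T) :=
    (integrable_const _).sub ((integrable_numPulls π ν T k).div_const _)
  have hEz (ν : Problem K) : ∫ h, z h ∂historyLaw π ν T = 1 - expectedPulls π ν k T / T := by
    simp only [z]
    rw [integral_sub (integrable_const _) ((integrable_numPulls π ν T k).div_const _),
      integral_div]
    simp [expectedPulls]
  have hbound h : |l * z h| ≤ l := by
    rw [abs_of_nonneg (mul_nonneg hl (hz0 h))]
    exact mul_le_of_le_one_right hl (hz1 h)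
  have hDV := integral_le_toReal_klDiv_add_log (ne_top_of_le_ne_top htop hle)
    (hz.const_mul l) hbound
  have hexp : Integrable (fun h => Real.exp (l * z h)) (historyLaw π ν' T) :=
    .of_bound (hz.const_mul l).exp.aestronglyMeasurable (Real.exp l) (.of_forall fun h => by
      simpa [abs_of_pos (Real.exp_pos _)] using (le_abs_self _).trans (hbound h))
  have hlog : Real.log (∫ h, Real.exp (l * z h) ∂historyLaw π ν' T) ≤
      Real.log (1 + (Real.exp l - 1) * (1 - expectedPulls π ν' k T / T)) := by
    refine Real.log_le_log (integral_exp_pos hexp) ?_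
    have hI := integral_mono hexp ((integrable_const (1 : ℝ)).add
      ((hzint ν').const_mul (Real.exp l - 1))) fun h => exp_mul_le_one_add (hz0 h) (hz1 h)
    refine hI.trans_eq ?_
    simp only [Pi.add_apply]
    rw [integral_add (integrable_const _) ((hzint ν').const_mul _), integral_const_mul, hEz]
    simp
  rw [integral_const_mul, hEz] at hDV
  linarith

/-! ### Asymptotic lower bounds -/

open Filter Topology in
/-- The asymptotic lower bound on the number of pulls given by one alternative law `q` of arm
`k`. -/
theorem inv_klDiv_le_liminf_expectedPulls {ε : ℝ} (hε : 0 ≤ ε) {f : ℝ → ℝ}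
    (hf : IsGapFunction ε f) {D : Set (ProbabilityMeasure unitInterval)} {π : Strategy K}
    (hπ : IsConsistent D f π) {ν : Problem K} (hν : ∀ a, ν a ∈ D) {k : Fin K}
    (hk : ε < gap ν k) {q : ProbabilityMeasure unitInterval} (hqD : q ∈ D)
    (hq : bestMean ν + ε < mean q) :
    (klDiv (ν k : Measure unitInterval) (q : Measure unitInterval))⁻¹ ≤
      liminf (fun T : ℕ => ENNReal.ofReal (expectedPulls π ν k T / Real.log T)) atTop := by
  by_cases htop : klDiv (ν k : Measure unitInterval) (q : Measure unitInterval) = ⊤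
  · simp [htop]
  -- Since `ε ≥ 0`, the mean of `q` exceeds `μ*`, so `q` differs from `ν k`.
  have hne : klDiv (ν k : Measure unitInterval) (q : Measure unitInterval) ≠ 0 := by
    rw [Ne, klDiv_eq_zero_iff]
    intro h
    have h1 : mean (ν k) = mean q := by rw [mean, mean, h]
    have h2 := mean_le_bestMean ν k
    linarith
  set κ := (klDiv (ν k : Measure unitInterval) (q : Measure unitInterval)).toReal with hκ
  have hκpos : 0 < κ := ENNReal.toReal_pos hne htop
  set ν' := Function.update ν k q with hν'
  have hν'D : ∀ a, ν' a ∈ D := by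
    intro a
    obtain rfl | ha := eq_or_ne a k
    · simpa [hν'] using hqD
    · simpa [hν', ha] using hν a
  have hfrac : Tendsto (fun T : ℕ => expectedPulls π ν k T / T) atTop (𝓝 0) := by
    have := (hπ.isLittleO_expectedPulls hf hν hk one_pos le_rfl).tendsto_div_nhds_zero
    simpa only [Real.rpow_one] using this
  have hlogT : Tendsto (fun T : ℕ => Real.log T) atTop atTop :=
    Real.tendsto_log_atTop.comp tendsto_natCast_atTop_atTop
  have key (α : ℝ) (hα : 0 < α) (hα1 : α ≤ 1) : ENNReal.ofReal ((1 - α) / κ) ≤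
      liminf (fun T : ℕ => ENNReal.ofReal (expectedPulls π ν k T / Real.log T)) atTop := by
    -- This difference is the expected number of pulls of the other arms, all of gap above `ε` under
    -- `ν'`.
    have hrest : (fun T : ℕ => (T : ℝ) - expectedPulls π ν' k T) =o[atTop]
        fun T : ℕ => (T : ℝ) ^ α := by
      have : (fun T : ℕ => (T : ℝ) - expectedPulls π ν' k T) =
          ∑ a ∈ Finset.univ.erase k, fun T : ℕ => expectedPulls π ν' a T := by
        ext T
        rw [Finset.sum_apply, ← sum_expectedPulls π ν' T, ← Finset.add_sum_erase _ _ (Finset.mem_univ k),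
          add_sub_cancel_left]
      rw [this]
      exact Asymptotics.IsLittleO.sum fun a ha => hπ.isLittleO_expectedPulls hf hν'D
        (lt_gap_update ν k q hq (Finset.ne_of_mem_erase ha)) hα hα1
    have hev : ∀ᶠ T : ℕ in atTop,
        ((1 - α) * (1 - expectedPulls π ν k T / T) - Real.log 2 / Real.log T) / κ ≤
          expectedPulls π ν k T / Real.log T := by
      filter_upwards [hrest.def one_pos, eventually_gt_atTop 1] with T hT hT1
      have hT0 : (0 : ℝ) < T := by exact_mod_cast zero_lt_one.trans hT1
      have hlog : 0 < Real.log T := Real.log_pos (by exact_mod_cast hT1)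
      -- With this `l`, `exp l = T / T ^ α` exactly offsets the bound `T ^ α / T` on the fraction of
      -- other pulls under `ν'`, so the logarithm is at most `log 2`.
      have hcm := mul_one_sub_expectedPulls_le π ν k q htop
        (mul_nonneg (sub_nonneg.2 hα1) hlog.le) T
      rw [← hκ, ← hν'] at hcm
      have hR : (T : ℝ) - expectedPulls π ν' k T ≤ (T : ℝ) ^ α := by
        rw [one_mul, Real.norm_of_nonneg (Real.rpow_nonneg hT0.le α)] at hT
        exact (le_abs_self _).trans hT
      have hR0 : 0 ≤ (T : ℝ) - expectedPulls π ν' k T := by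
        rw [← sum_expectedPulls π ν' T, sub_nonneg]
        exact Finset.single_le_sum (f := fun a => expectedPulls π ν' a T)
          (fun a _ => expectedPulls_nonneg π ν' a T) (Finset.mem_univ k)
      have hfr : 1 - expectedPulls π ν' k T / T = (T - expectedPulls π ν' k T) / T := by
        field_simp
      have hexp : Real.exp ((1 - α) * Real.log T) = (T : ℝ) / (T : ℝ) ^ α := by
        rw [mul_comm, ← Real.rpow_def_of_pos hT0, Real.rpow_sub hT0, Real.rpow_one]
      have hone : 1 ≤ Real.exp ((1 - α) * Real.log T) :=
        Real.one_le_exp (mul_nonneg (sub_nonneg.2 hα1) hlog.le)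
      have hsmall : (Real.exp ((1 - α) * Real.log T) - 1) *
          (1 - expectedPulls π ν' k T / T) ≤ 1 := by
        have hpow : 0 < (T : ℝ) ^ α := Real.rpow_pos_of_pos hT0 α
        calc _ ≤ Real.exp ((1 - α) * Real.log T) * (1 - expectedPulls π ν' k T / T) := by
              refine mul_le_mul_of_nonneg_right (by linarith) ?_
              rw [hfr]; positivity
          _ = (T - expectedPulls π ν' k T) / (T : ℝ) ^ α := by
              rw [hexp, hfr]; field_simp
          _ ≤ 1 := (div_le_one hpow).2 hR
      have hpos : 0 ≤ (Real.exp ((1 - α) * Real.log T) - 1) *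
          (1 - expectedPulls π ν' k T / T) := by
        rw [hfr]
        exact mul_nonneg (by linarith) (by positivity)
      have hlog2 := Real.log_le_log (by linarith) (show 1 + (Real.exp ((1 - α) * Real.log T) - 1) *
          (1 - expectedPulls π ν' k T / T) ≤ 2 by linarith)
      rw [div_le_div_iff₀ hκpos hlog, sub_mul, div_mul_cancel₀ _ hlog.ne']
      linarith
    have hlim : Tendsto (fun T : ℕ => ENNReal.ofReal
        (((1 - α) * (1 - expectedPulls π ν k T / T) - Real.log 2 / Real.log T) / κ)) atTop
        (𝓝 (ENNReal.ofReal ((1 - α) / κ))) := by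
      refine ENNReal.tendsto_ofReal ?_
      have := (((hfrac.const_sub 1).const_mul (1 - α)).sub
        (hlogT.const_div_atTop (Real.log 2))).div_const κ
      simpa using this
    rw [← hlim.liminf_eq]
    exact liminf_le_liminf (hev.mono fun T hT => ENNReal.ofReal_le_ofReal hT)
  have hlim : Tendsto (fun α : ℝ => ENNReal.ofReal ((1 - α) / κ)) (𝓝[>] 0)
      (𝓝 (ENNReal.ofReal ((1 - 0) / κ))) := by
    refine ENNReal.tendsto_ofReal (Tendsto.mono_left ?_ nhdsWithin_le_nhds)
    exact Continuous.tendsto (by fun_prop) 0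
  have := le_of_tendsto hlim (by
    filter_upwards [Ioc_mem_nhdsGT (zero_lt_one (α := ℝ))] with α hα using key α hα.1 hα.2)
  rwa [sub_zero, one_div, ENNReal.ofReal_inv_of_pos hκpos, ENNReal.ofReal_toReal htop] at this

open Filter in
-- Fatou's lemma for the counting measure on `s`.
theorem sum_liminf_le_liminf_sum {ι : Type*} (s : Finset ι) (u : ι → ℕ → ℝ≥0∞) :
    ∑ i ∈ s, liminf (u i) atTop ≤ liminf (fun n => ∑ i ∈ s, u i n) atTop := by
  let _ : MeasurableSpace s := ⊤
  have := lintegral_liminf_le (u := atTop) (μ := (Measure.count : Measure s)) (f := fun n i => u i n)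
    fun n => measurable_from_top
  simp only [lintegral_fintype, Measure.count_singleton, mul_one, Finset.univ_eq_attach] at this
  rw [Finset.sum_attach s fun i => liminf (fun n => u i n) atTop] at this
  simpa only [fun n => Finset.sum_attach s fun i => u i n] using this

theorem inv_Kinf_le_liminf_expectedPulls {ε : ℝ} (hε : 0 ≤ ε) {f : ℝ → ℝ}
    (hf : IsGapFunction ε f) {D : Set (ProbabilityMeasure unitInterval)} {π : Strategy K}
    (hπ : IsConsistent D f π) {ν : Problem K} (hν : ∀ a, ν a ∈ D) {k : Fin K}
    (hk : ε < gap ν k) :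
    (Kinf (ν k) (bestMean ν + ε) D)⁻¹ ≤
      Filter.liminf (fun T : ℕ => ENNReal.ofReal (expectedPulls π ν k T / Real.log T))
        Filter.atTop := by
  -- Inversion reverses order, so the bounds for individual `q` pass to the infimum, including the
  -- values `0` and `⊤`.
  rw [ENNReal.inv_le_iff_inv_le]
  refine le_iInf₂ fun q hq => ?_
  rw [← ENNReal.inv_le_iff_inv_le]
  exact inv_klDiv_le_liminf_expectedPulls hε hf hπ hν hk hq.1 hq.2

theorem sum_div_Kinf_le_liminf_lenientRegret {ε : ℝ} (hε : 0 ≤ ε) {f : ℝ → ℝ}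
    (hf : IsGapFunction ε f) {D : Set (ProbabilityMeasure unitInterval)} {π : Strategy K}
    (hπ : IsConsistent D f π) {ν : Problem K} (hν : ∀ a, ν a ∈ D) :
    ∑ a : Fin K with ε < gap ν a, ENNReal.ofReal (f (gap ν a)) / Kinf (ν a) (bestMean ν + ε) D ≤
      Filter.liminf (fun T : ℕ => ENNReal.ofReal (lenientRegret f π ν T / Real.log T))
        Filter.atTop := by
  calc _ ≤ ∑ a : Fin K with ε < gap ν a, Filter.liminf (fun T : ℕ => ENNReal.ofReal (f (gap ν a)) *
          ENNReal.ofReal (expectedPulls π ν a T / Real.log T)) Filter.atTop := by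
        refine Finset.sum_le_sum fun a ha => ?_
        rw [ENNReal.liminf_const_mul_of_ne_top ENNReal.ofReal_ne_top, div_eq_mul_inv]
        gcongr
        exact inv_Kinf_le_liminf_expectedPulls hε hf hπ hν (Finset.mem_filter.1 ha).2
    _ ≤ _ := sum_liminf_le_liminf_sum _ _
    _ ≤ _ := by
        refine Filter.liminf_le_liminf (.of_forall fun T => ?_)
        have hterm a : 0 ≤ f (gap ν a) * (expectedPulls π ν a T / Real.log T) :=
          mul_nonneg (hf.nonneg_gap ν a)
            (div_nonneg (expectedPulls_nonneg π ν a T) (Real.log_natCast_nonneg T))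
        simp only [← ENNReal.ofReal_mul (hf.nonneg_gap ν _)]
        rw [← ENNReal.ofReal_sum_of_nonneg fun a _ => hterm a, lenientRegret_eq_sum,
          Finset.sum_div]
        refine ENNReal.ofReal_le_ofReal ?_
        simp only [mul_div_assoc]
        -- Arms of gap at most `ε` contribute nonnegative terms and may be dropped.
        exact Finset.sum_le_sum_of_subset_of_nonneg (Finset.filter_subset _ _) fun a _ _ => hterm a

/-- No law on `[0,1]` has mean above `1`, so the infimum is over the empty set. -/
theorem Kinf_eq_top {x : ℝ} (hx : 1 ≤ x) (p : ProbabilityMeasure unitInterval)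
    (D : Set (ProbabilityMeasure unitInterval)) : Kinf p x D = ⊤ :=
  iInf₂_eq_top.2 fun q hq => absurd (hq.2.trans_le (mean_le_one q)) hx.not_gt

end LenientBandit

theorem mainTheorem3 {K : ℕ} (ε : ℝ) (hε : ε ∈ Set.Icc (0 : ℝ) 1)
    (f : ℝ → ℝ) (hf : LenientBandit.IsGapFunction ε f)
    (D : Set (MeasureTheory.ProbabilityMeasure unitInterval))
    (π : LenientBandit.Strategy K) (hπ : LenientBandit.IsConsistent D f π)
    (ν : LenientBandit.Problem K) (hν : ∀ a, ν a ∈ D) :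
    (∀ k : Fin K, ε < LenientBandit.gap ν k →
      1 / LenientBandit.Kinf (ν k) (LenientBandit.bestMean ν + ε) D ≤
        Filter.liminf (fun T : ℕ =>
          ENNReal.ofReal (LenientBandit.expectedPulls π ν k T / Real.log T)) Filter.atTop) ∧
    (∑ a : Fin K with ε < LenientBandit.gap ν a,
        ENNReal.ofReal (f (LenientBandit.gap ν a)) /
          LenientBandit.Kinf (ν a) (LenientBandit.bestMean ν + ε) D ≤
      Filter.liminf (fun T : ℕ =>
        ENNReal.ofReal (LenientBandit.lenientRegret f π ν T / Real.log T)) Filter.atTop) ∧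
    (1 - ε < LenientBandit.bestMean ν →
      (∀ a : Fin K, LenientBandit.Kinf (ν a) (LenientBandit.bestMean ν + ε) D = ⊤) ∧
      ∑ a : Fin K with ε < LenientBandit.gap ν a,
        ENNReal.ofReal (f (LenientBandit.gap ν a)) /
          LenientBandit.Kinf (ν a) (LenientBandit.bestMean ν + ε) D = 0) := by
  refine ⟨fun k hk => ?_, LenientBandit.sum_div_Kinf_le_liminf_lenientRegret hε.1 hf hπ hν,
    fun hbest => ?_⟩
  · rw [one_div]
    exact LenientBandit.inv_Kinf_le_liminf_expectedPulls hε.1 hf hπ hν hk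
  · have htop (a : Fin K) : LenientBandit.Kinf (ν a) (LenientBandit.bestMean ν + ε) D = ⊤ :=
      LenientBandit.Kinf_eq_top (by linarith) (ν a) D
    exact ⟨htop, Finset.sum_eq_zero fun a _ => by rw [htop a, ENNReal.div_top]⟩
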